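/- Let $\kappa,\gamma,a_1,a_2>0$, and consider the relay feedback system whose plant $\dfrac{\kappa s+\gamma}{s^2+a_1s+a_2}$ is given in the observer realization $$A=\begin{pmatrix}0&-a_2\\1&-a_1\end{pmatrix},\qquad B=\begin{pmatrix}\gamma\\ \kappa\end{pmatrix},\qquad C=\begin{pmatrix}0&1\end{pmatrix},$$ so that the state evolves by $\dot x=Ax-B\,\mathrm{sign}(Cx)$. A trajectory is a Filippov solution on $[0,\infty)$: a locally absolutely continuous $x:[0,\infty)\to\mathbb R^2$ such that for almost every $t$ one has $\dot x=Ax-B$ if $Cx>0$, $\dot x=Ax+B$ if $Cx<0$, and $\dot x\in\{Ax+uB: u\in[-1,1]\}$ if $Cx=0$. For $\xi\in\mathbb R^2$ put $\tau_\pm(\xi)=\inf\{t>0:\ \mp Cx(t)>0\}$, where $\dot x=Ax\mp B$, $x(0)=\xi$ (with $\inf\emptyset=+\infty$). For real $\xi$ let $f_+(\xi)$ be the first coordinate, at time $\tau_+(\xi,0)$, of the solution of $\dot x=Ax-B$ starting at $(\xi,0)$. A point $\xi$ with $C\xi=0$ is a chattering point if $\tau_+(\xi)=\tau_-(\xi)=0$;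 let $\mathcal K$ be the set of chattering points. Then: 1. $\mathcal K=\{(x_1,0): |x_1|\le\kappa\}$; it is bounded and has Lebesgue measure zero. 2. $\tau_+(\xi,0)<\infty$ for every real $\xi$, so $f_+$ is defined on all of $\mathbb R$, and $-f_+(\xi)<\xi-2\kappa$ for every $\xi>\kappa$. 3. For every $\xi_0\in\mathbb R$ let $\xi_{n+1}=-f_+(\xi_n)$. For every $n\ge1$, either $|\xi_n|\le\kappa$ or $\xi_{n+1}<\xi_n-2\kappa$; and $|\xi_n|\le\kappa$ for all sufficiently large $n$. 4. If a trajectory is in $\mathcal K$ at some time, it is in $\mathcal K$ at all later times; and every trajectory $x$ converges asymptotically to $\mathcal K$, that is, $\mathrm{dist}(x(t),\mathcal K)\to0$ as $t\to\infty$. -/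

import Mathlib

open Set Filter Topology MeasureTheory Matrix

noncomputable section

namespace RelayFeedback

/-- State matrix `A` of the observer realization of `(κ s + γ) / (s² + a₁ s + a₂)`. -/
def plantA (a₁ a₂ : ℝ) : Matrix (Fin 2) (Fin 2) ℝ := !![0, -a₂; 1, -a₁]

/-- Input vector `B` of the observer realization of `(κ s + γ) / (s² + a₁ s + a₂)`. -/
def plantB (κ γ : ℝ) : Fin 2 → ℝ := ![γ, κ]

/-- Output vector `C` of the observer realization; the output is `C x = x₂`. -/
def plantC : Fin 2 → ℝ := ![0, 1]

/-- `(plantA, plantB, plantC)` realizes the plant: `C (s I - A)⁻¹ B = (κ s + γ)/(s² + a₁ s + a₂)`. -/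
theorem plant_transferFunction (κ γ a₁ a₂ : ℝ) (s : ℂ) (_hs : s ^ 2 + a₁ * s + a₂ ≠ 0) :
    (fun i => (plantC i : ℂ)) ⬝ᵥ
        ((s • (1 : Matrix (Fin 2) (Fin 2) ℂ) - (plantA a₁ a₂).map Complex.ofReal)⁻¹ *ᵥ
          fun i => (plantB κ γ i : ℂ))
      = (κ * s + γ) / (s ^ 2 + a₁ * s + a₂) := by
  have hM : s • (1 : Matrix (Fin 2) (Fin 2) ℂ) - (plantA a₁ a₂).map Complex.ofReal
      = !![s, (a₂ : ℂ); -1, s + a₁] := by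
    ext i j
    fin_cases i <;> fin_cases j <;> simp [plantA]
  have hdet : (!![s, (a₂ : ℂ); -1, s + a₁]).det = s ^ 2 + a₁ * s + a₂ := by
    rw [Matrix.det_fin_two_of]; ring
  rw [hM, Matrix.inv_def, hdet, Matrix.adjugate_fin_two_of, Ring.inverse_eq_inv']
  simp [plantB, plantC, Matrix.mulVec, dotProduct, Fin.sum_univ_two]
  field_simp
  ring

section General

variable (A : Matrix (Fin 2) (Fin 2) ℝ) (B C : Fin 2 → ℝ)

/-- Filippov's set-valued right-hand side for `x' = A x - B sign (C x)`. -/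
def filippovField (x : Fin 2 → ℝ) : Set (Fin 2 → ℝ) :=
  if 0 < C ⬝ᵥ x then {A *ᵥ x - B}
  else if C ⬝ᵥ x < 0 then {A *ᵥ x + B}
  else {v | ∃ u ∈ Icc (-1 : ℝ) 1, v = A *ᵥ x + u • B}

/-- A trajectory of the relay feedback system on `[0, ∞)`: a Filippov solution, i.e. a locally
absolutely continuous curve that satisfies the differential inclusion at almost every time. -/
structure IsTrajectory (x : ℝ → Fin 2 → ℝ) : Prop where
  absCont : ∀ T : ℝ, 0 < T → AbsolutelyContinuousOnInterval x 0 T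
  inclusion : ∀ᵐ t ∂(volume : Measure ℝ), 0 < t →
    ∃ v ∈ filippovField A B C (x t), HasDerivAt x v t

/-- The solution of `x' = A x - u B`, `x 0 = ξ` (constant relay output `u`) when `A` is
invertible. -/
def constFlow (u : ℝ) (ξ : Fin 2 → ℝ) (t : ℝ) : Fin 2 → ℝ :=
  u • (A⁻¹ *ᵥ B) + NormedSpace.exp (t • A) *ᵥ (ξ - u • (A⁻¹ *ᵥ B))

/-- Times at which the output is negative under relay output `+1`. -/
def exitTimesPlus (ξ : Fin 2 → ℝ) : Set ℝ := {t | 0 < t ∧ C ⬝ᵥ constFlow A B 1 ξ t < 0}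

/-- Times at which the output is positive under relay output `-1`. -/
def exitTimesMinus (ξ : Fin 2 → ℝ) : Set ℝ := {t | 0 < t ∧ 0 < C ⬝ᵥ constFlow A B (-1) ξ t}

/-- First exit time from positive sign (meaningful when `exitTimesPlus` is nonempty). -/
def tauPlus (ξ : Fin 2 → ℝ) : ℝ := sInf (exitTimesPlus A B C ξ)

/-- First exit map from positive sign. -/
def psiPlus (ξ : Fin 2 → ℝ) : Fin 2 → ℝ := constFlow A B 1 ξ (tauPlus A B C ξ)

/-- Switching point transformation function: first coordinate of the first exit map, along
the switching line `{(ξ, 0)}`. -/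
def fPlus (ξ : ℝ) : ℝ := psiPlus A B C ![ξ, 0] 0

/-- The switching points up to sign: `ξ₀, -f₊(ξ₀), -f₊(-f₊(ξ₀)), …`. -/
def switchingSeq (ξ₀ : ℝ) (n : ℕ) : ℝ := (fun ξ => -fPlus A B C ξ)^[n] ξ₀

/-- Chattering points: points of the switching line at which both first exit times are zero,
so that the relay switches back instantaneously whichever sign it takes. -/
def chatteringSet : Set (Fin 2 → ℝ) :=
  {ξ | C ⬝ᵥ ξ = 0 ∧ IsGLB (exitTimesPlus A B C ξ) 0 ∧ IsGLB (exitTimesMinus A B C ξ) 0}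

open scoped Matrix.Norms.Operator in
theorem constFlow_hasDerivAt (hA : IsUnit A.det) (u : ℝ) (ξ : Fin 2 → ℝ) (t : ℝ) :
    HasDerivAt (constFlow A B u ξ) (A *ᵥ constFlow A B u ξ t - u • B) t := by
  have h := hasDerivAt_exp_smul_const' (𝕂 := ℝ) A t
  have h2 := (LinearMap.toContinuousLinearMap
    (LinearMap.flip (Matrix.mulVecBilin ℝ ℝ) (ξ - u • (A⁻¹ *ᵥ B)) :
      Matrix (Fin 2) (Fin 2) ℝ →ₗ[ℝ] Fin 2 → ℝ)).hasFDerivAt.comp_hasDerivAt t h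
  have h3 := h2.const_add (u • (A⁻¹ *ᵥ B))
  have hv : A *ᵥ constFlow A B u ξ t - u • B
      = (A * NormedSpace.exp (t • A)) *ᵥ (ξ - u • (A⁻¹ *ᵥ B)) := by
    rw [constFlow, Matrix.mulVec_add, Matrix.mulVec_smul, Matrix.mulVec_mulVec,
      Matrix.mulVec_mulVec, Matrix.mul_nonsing_inv A hA, Matrix.one_mulVec, add_sub_cancel_left]
  rw [hv]
  exact h3

theorem constFlow_zero (u : ℝ) (ξ : Fin 2 → ℝ) : constFlow A B u ξ 0 = ξ := by
  rw [constFlow, zero_smul, NormedSpace.exp_zero, Matrix.one_mulVec, add_sub_cancel]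

end General

end RelayFeedback

end

/-! Write `p`, `q` for the state coordinates. Two energies carry the argument.

Under relay output 1, `(p - κ)² / 2 + a₂ q² / 2 + γ q` has derivative `-a₁ q (a₂ q + γ)`. Between a
start `(ξ, 0)` with `ξ > κ` and its exit point `(f, 0)` it strictly drops, so `|f - κ| < ξ - κ`,
which is the bound on `-f₊` (`IsPlusFlow.exit_bounds`). For `ξ ≤ κ` the exit is immediate and `f₊`
fixes `ξ`. The statements on iterates use only this (`iterate_neg_eventually_mem_Icc`).

Centred at `p = 0`, with `γ |q|` in place of `γ q`, the energy falls at rate at least `κ γ` off the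
switching line. At almost every time on the line, `q' = 0` forces `p = u κ` with `|u| ≤ 1`, a
chattering point. A nonnegative energy cannot fall forever, so the chattering set is reached in
finite time (`exists_mem`). It is forward invariant (`mem_of_le`), so the distance to it is
eventually zero. -/

/-! ### Calculus of absolutely continuous functions. -/

/-- Postcomposition with a Lipschitz map preserves absolute continuity. -/
theorem LipschitzWith.comp_absolutelyContinuousOnInterval {X Y : Type*} [PseudoMetricSpace X]
    [PseudoMetricSpace Y] {K : NNReal} {g : X → Y} (hg : LipschitzWith K g) {f : ℝ → X} {a b : ℝ}
    (hf : AbsolutelyContinuousOnInterval f a b) :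
    AbsolutelyContinuousOnInterval (fun t => g (f t)) a b := by
  refine squeeze_zero (fun E => Finset.sum_nonneg fun i _ => dist_nonneg) (fun E => ?_)
    (by simpa using Tendsto.const_mul (K : ℝ) hf)
  rw [Finset.mul_sum]
  exact Finset.sum_le_sum fun i _ => hg.dist_le_mul _ _

/-- Mean value inequality for absolutely continuous functions. -/
theorem AbsolutelyContinuousOnInterval.sub_le_mul_of_ae_deriv_le {f : ℝ → ℝ} {a b c : ℝ}
    (hab : a ≤ b) (hf : AbsolutelyContinuousOnInterval f a b)
    (h : ∀ᵐ t : ℝ, t ∈ Ioo a b → ∃ d ≤ c, HasDerivAt f d t) :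
    f b - f a ≤ c * (b - a) := by
  have hmono : ∫ t in a..b, deriv f t ≤ ∫ _ in a..b, c := by
    refine intervalIntegral.integral_mono_ae_restrict hab hf.intervalIntegrable_deriv
      intervalIntegrable_const ?_
    rw [EventuallyLE, ← restrict_Ioo_eq_restrict_Icc, ae_restrict_iff' measurableSet_Ioo]
    filter_upwards [h] with t ht htm
    obtain ⟨d, hd, hfd⟩ := ht htm
    rwa [hfd.deriv]
  rw [hf.integral_deriv_eq_sub, intervalIntegral.integral_const, smul_eq_mul] at hmono
  linarith

/-- A barrier principle: an absolutely continuous function that is nonincreasing while positive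
and starts nonpositive stays nonpositive. -/
theorem AbsolutelyContinuousOnInterval.nonpos_of_ae_deriv_nonpos_of_pos {f : ℝ → ℝ} {a b : ℝ}
    (hf : AbsolutelyContinuousOnInterval f a b) (ha : f a ≤ 0)
    (h : ∀ᵐ t : ℝ, t ∈ Ioo a b → 0 < f t → ∃ d ≤ 0, HasDerivAt f d t) {t : ℝ}
    (ht : t ∈ Icc a b) : f t ≤ 0 := by
  by_contra! hpos
  have hab : a ≤ b := ht.1.trans ht.2
  have hcont : ContinuousOn f (Icc a t) := by
    refine hf.continuousOn.mono ?_
    rw [uIcc_of_le hab]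
    exact Icc_subset_Icc_right ht.2
  have hcl : IsClosed (Icc a t ∩ f ⁻¹' Iic 0) :=
    hcont.preimage_isClosed_of_isClosed isClosed_Icc isClosed_Iic
  -- `s` is the last time up to `t` with `f ≤ 0`; after it `f` is positive, hence nonincreasing.
  obtain ⟨s, ⟨⟨has, hst⟩, hs⟩, hub⟩ :=
    (isCompact_Icc.of_isClosed_subset hcl inter_subset_left).exists_isGreatest
      ⟨a, left_mem_Icc.2 ht.1, ha⟩
  have hsub : uIcc s t ⊆ uIcc a b := by
    rw [uIcc_of_le hst, uIcc_of_le hab]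
    exact Icc_subset_Icc has ht.2
  have := (hf.mono hsub).sub_le_mul_of_ae_deriv_le hst (c := 0) (by
    filter_upwards [h] with r hr hrm
    refine hr ⟨has.trans_lt hrm.1, hrm.2.trans_le ht.2⟩ ?_
    by_contra! hneg
    exact hrm.1.not_ge (hub ⟨⟨has.trans hrm.1.le, hrm.2.le⟩, hneg⟩))
  have hs' : f s ≤ 0 := hs
  linarith

/-- At a zero of `f` where `|f|` is differentiable, the derivative of `f` vanishes. -/
theorem HasDerivAt.eq_zero_of_differentiableAt_abs {f : ℝ → ℝ} {d t : ℝ} (hf : HasDerivAt f d t)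
    (h0 : f t = 0) (habs : DifferentiableAt ℝ (fun s => |f s|) t) : d = 0 := by
  have hmin : IsLocalMin (fun s => |f s|) t :=
    Eventually.of_forall fun s => by simp [h0]
  have hz : HasDerivAt (fun s => |f s|) 0 t := by
    have := habs.hasDerivAt
    rwa [hmin.deriv_eq_zero] at this
  refine hf.unique ?_
  -- With derivative 0 and value 0, the remainder condition sees `f` only through `|f|`.
  rw [hasDerivAt_iff_isLittleO] at hz ⊢
  refine (Asymptotics.isLittleO_norm_left.1 ?_)
  refine (Asymptotics.isLittleO_norm_left.2 hz).congr_left fun s => ?_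
  simp [h0]

/-- A function vanishing at `s` with positive derivative there is positive just after `s`. -/
theorem HasDerivAt.exists_pos_right {f : ℝ → ℝ} {d s : ℝ} (hf : HasDerivAt f d s) (h0 : f s = 0)
    (hd : 0 < d) : ∃ ε > 0, ∀ t ∈ Ioo s (s + ε), 0 < f t := by
  have h1 : ∀ᶠ t in 𝓝[>] s, 0 < slope f s t :=
    (hf.tendsto_slope.mono_left (nhdsWithin_mono _ fun t ht => ne_of_gt ht)).eventually
      (lt_mem_nhds hd)
  obtain ⟨r, hr, hsub⟩ := mem_nhdsGT_iff_exists_Ioo_subset.1 h1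
  refine ⟨r - s, sub_pos.2 hr, fun t ht => ?_⟩
  rw [add_sub_cancel] at ht
  have := hsub ht
  simp only [slope_def_field, h0, sub_zero, mem_ofPred_eq] at this
  rwa [div_pos_iff_of_pos_right (sub_pos.2 ht.1)] at this

/-! ### Filippov trajectories: invariance and finite-time arrival. -/

namespace RelayFeedback

/-- The scalar form of a Filippov solution of the relay system: `p` and `q` are the two state
coordinates. On the switching line the relay output is forced to be the equivalent control. -/
structure IsScalarTrajectory (κ γ a₁ a₂ : ℝ) (p q : ℝ → ℝ) : Prop where
  absCont_fst : ∀ T : ℝ, 0 < T → AbsolutelyContinuousOnInterval p 0 T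
  absCont_snd : ∀ T : ℝ, 0 < T → AbsolutelyContinuousOnInterval q 0 T
  ae_hasDerivAt : ∀ᵐ t : ℝ, 0 < t → ∃ u ∈ Icc (-1 : ℝ) 1,
    HasDerivAt p (-a₂ * q t - u * γ) t ∧ HasDerivAt q (p t - a₁ * q t - u * κ) t ∧
    (0 < q t → u = 1) ∧ (q t < 0 → u = -1) ∧ (q t = 0 → p t = u * κ)

theorem plantC_dotProduct (x : Fin 2 → ℝ) : plantC ⬝ᵥ x = x 1 := by
  simp [plantC, dotProduct, Fin.sum_univ_two]

theorem mem_filippovField_plant {κ γ a₁ a₂ : ℝ} {x v : Fin 2 → ℝ}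
    (hv : v ∈ filippovField (plantA a₁ a₂) (plantB κ γ) plantC x) :
    ∃ u ∈ Icc (-1 : ℝ) 1, v 0 = -a₂ * x 1 - u * γ ∧ v 1 = x 0 - a₁ * x 1 - u * κ ∧
      (0 < x 1 → u = 1) ∧ (x 1 < 0 → u = -1) := by
  rw [filippovField, plantC_dotProduct] at hv
  split_ifs at hv with h1 h2
  · rw [mem_singleton_iff] at hv
    refine ⟨1, by simp, ?_, ?_, fun _ => rfl, fun h => absurd h h1.not_gt⟩ <;>
      simp [hv, plantA, plantB, dotProduct, Fin.sum_univ_two] <;> ring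
  · rw [mem_singleton_iff] at hv
    refine ⟨-1, by simp, ?_, ?_, fun h => absurd h h1, fun _ => rfl⟩ <;>
      simp [hv, plantA, plantB, dotProduct, Fin.sum_univ_two] <;> ring
  · obtain ⟨u, hu, rfl⟩ := hv
    -- Filippov's selection enters as `+u B`, the relay output as `-u B`.
    refine ⟨-u, ⟨neg_le_neg hu.2, by linarith [hu.1]⟩, ?_, ?_, fun h => absurd h h1,
      fun h => absurd h h2⟩ <;>
      simp [plantA, plantB, dotProduct, Fin.sum_univ_two] <;> ring

/-- The equivalent control comes for free: `|q|` is absolutely continuous, hence differentiable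
almost everywhere, and where it is differentiable at a zero of `q`, `q' = 0`. -/
theorem IsTrajectory.isScalarTrajectory {κ γ a₁ a₂ : ℝ} {x : ℝ → Fin 2 → ℝ}
    (hx : IsTrajectory (plantA a₁ a₂) (plantB κ γ) plantC x) :
    IsScalarTrajectory κ γ a₁ a₂ (fun t => x t 0) (fun t => x t 1) := by
  have hac : ∀ i : Fin 2, ∀ T : ℝ, 0 < T → AbsolutelyContinuousOnInterval (fun t => x t i) 0 T :=
    fun i T hT => LipschitzWith.comp_absolutelyContinuousOnInterval (K := 1)
      (g := fun v : Fin 2 → ℝ => v i) (LipschitzWith.of_dist_le_mul fun v w => by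
        simpa using dist_le_pi_dist v w i) (hx.absCont T hT)
  refine ⟨hac 0, hac 1, ?_⟩
  have habs : ∀ᵐ t : ℝ, ∀ n : ℕ, t ∈ uIcc (0 : ℝ) (n + 1) →
      DifferentiableAt ℝ (fun s => |x s 1|) t :=
    ae_all_iff.2 fun n => ((lipschitzWith_one_norm (E := ℝ)).comp_absolutelyContinuousOnInterval
      (hac 1 (n + 1) (by positivity))).ae_differentiableAt
  filter_upwards [hx.inclusion, habs] with t ht hd ht0
  obtain ⟨v, hv, hxv⟩ := ht ht0
  obtain ⟨u, hu, hv0, hv1, hpos, hneg⟩ := mem_filippovField_plant hv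
  have hder := hasDerivAt_pi.1 hxv
  refine ⟨u, hu, hv0 ▸ hder 0, hv1 ▸ hder 1, hpos, hneg, fun hz => ?_⟩
  obtain ⟨n, hn⟩ := exists_nat_gt t
  have hzero := (hder 1).eq_zero_of_differentiableAt_abs hz (hd n (by
    rw [uIcc_of_le (by positivity)]; exact ⟨ht0.le, by linarith⟩))
  rw [hv1, hz] at hzero
  linarith

namespace IsScalarTrajectory

variable {κ γ a₁ a₂ : ℝ} {p q : ℝ → ℝ}

theorem neg (h : IsScalarTrajectory κ γ a₁ a₂ p q) :
    IsScalarTrajectory κ γ a₁ a₂ (fun t => -p t) (fun t => -q t) := by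
  refine ⟨fun T hT => (h.absCont_fst T hT).fun_neg, fun T hT => (h.absCont_snd T hT).fun_neg, ?_⟩
  filter_upwards [h.ae_hasDerivAt] with t ht ht0
  obtain ⟨u, hu, hp, hq, hpos, hneg, hz⟩ := ht ht0
  refine ⟨-u, ⟨neg_le_neg hu.2, by linarith [hu.1]⟩, ?_, ?_, fun h => ?_, fun h => ?_,
    fun h => ?_⟩
  · exact hp.fun_neg.congr_deriv (by ring)
  · exact hq.fun_neg.congr_deriv (by ring)
  · linarith [hneg (by linarith)]
  · linarith [hpos (by linarith)]
  · linarith [hz (by linarith)]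

theorem absCont_fst_of_le (h : IsScalarTrajectory κ γ a₁ a₂ p q) {s t : ℝ} (hs : 0 ≤ s)
    (hst : s < t) : AbsolutelyContinuousOnInterval p s t := by
  refine (h.absCont_fst t (hs.trans_lt hst)).mono ?_
  rw [uIcc_of_le hst.le, uIcc_of_le (hs.trans hst.le)]
  exact Icc_subset_Icc_left hs

theorem absCont_snd_of_le (h : IsScalarTrajectory κ γ a₁ a₂ p q) {s t : ℝ} (hs : 0 ≤ s)
    (hst : s < t) : AbsolutelyContinuousOnInterval q s t := by
  refine (h.absCont_snd t (hs.trans_lt hst)).mono ?_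
  rw [uIcc_of_le hst.le, uIcc_of_le (hs.trans hst.le)]
  exact Icc_subset_Icc_left hs

/-- From a point of the right half of the chattering set a trajectory stays in the chattering
set for a while. -/
theorem exists_forall_mem_of_nonneg (h : IsScalarTrajectory κ γ a₁ a₂ p q) (hκ : 0 < κ)
    (hγ : 0 < γ) (ha₁ : 0 < a₁) (ha₂ : 0 < a₂) {s : ℝ} (hs : 0 ≤ s) (hp0 : 0 ≤ p s)
    (hpκ : p s ≤ κ) (hq : q s = 0) :
    ∃ δ > 0, ∀ t ∈ Icc s (s + δ), p t ∈ Icc (-κ) κ ∧ q t = 0 := by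
  have hcont : ContinuousWithinAt p (Icc s (s + 1)) s := by
    have := (h.absCont_fst_of_le hs (lt_add_one s)).continuousOn
    rw [uIcc_of_le (lt_add_one s).le] at this
    exact this s ⟨le_rfl, by linarith⟩
  have hev : ∀ᶠ t in 𝓝[≥] s, -κ < p t := by
    rw [← nhdsWithin_Icc_eq_nhdsGE (lt_add_one s)]
    exact hcont.eventually (lt_mem_nhds (by linarith))
  obtain ⟨r, hr, hsub⟩ := (mem_nhdsGE_iff_exists_Icc_subset).1 hev
  have hlow : ∀ t ∈ Icc s r, -κ < p t := fun t ht => hsub ht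
  -- Where `q < 0`, the relay output is -1 and `q' = p - a₁ q + κ > 0`, because `p > -κ`.
  have hqnn : ∀ t ∈ Icc s r, 0 ≤ q t := by
    intro t ht
    have := (h.absCont_snd_of_le hs hr).fun_neg.nonpos_of_ae_deriv_nonpos_of_pos (by simp [hq]) (by
      filter_upwards [h.ae_hasDerivAt] with t ht htm hneg
      obtain ⟨u, -, -, hdq, -, hu, -⟩ := ht (hs.trans_lt htm.1)
      rw [hu (by linarith)] at hdq
      refine ⟨_, ?_, hdq.fun_neg⟩
      nlinarith [hlow t ⟨htm.1.le, htm.2.le⟩]) ht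
    linarith
  -- Where `p > κ`, almost every time has `q ≠ 0`, as `p = u κ` would fail; so `q > 0` and `p' = -a₂
  -- q - γ < 0`.
  have hple : ∀ t ∈ Icc s r, p t ≤ κ := by
    intro t ht
    have hac : AbsolutelyContinuousOnInterval (fun t => p t - κ) s r :=
      (h.absCont_fst_of_le hs hr).fun_sub
        (LipschitzOnWith.absolutelyContinuousOnInterval (K := 0)
          (LipschitzWith.const κ).lipschitzOnWith)
    have := hac.nonpos_of_ae_deriv_nonpos_of_pos (by linarith) (by
      filter_upwards [h.ae_hasDerivAt] with t ht htm hpos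
      obtain ⟨u, hu1, hdp, -, hu, -, hz⟩ := ht (hs.trans_lt htm.1)
      have hqpos : 0 < q t := by
        refine (hqnn t ⟨htm.1.le, htm.2.le⟩).lt_of_ne fun h0 => ?_
        have := hz h0.symm
        nlinarith [hu1.2]
      rw [hu hqpos] at hdp
      refine ⟨_, ?_, hdp.sub_const κ⟩
      nlinarith) ht
    linarith
  refine ⟨r - s, sub_pos.2 hr, fun t ht => ?_⟩
  rw [add_sub_cancel] at ht
  refine ⟨⟨(hlow t ht).le, hple t ht⟩, le_antisymm ?_ (hqnn t ht)⟩
  -- Now `p ≤ κ` makes `q' = p - a₁ q - κ` nonpositive where `q > 0`.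
  refine (h.absCont_snd_of_le hs hr).nonpos_of_ae_deriv_nonpos_of_pos hq.le ?_ ht
  filter_upwards [h.ae_hasDerivAt] with t ht htm hpos
  obtain ⟨u, -, -, hdq, hu, -, -⟩ := ht (hs.trans_lt htm.1)
  rw [hu hpos] at hdq
  refine ⟨_, ?_, hdq⟩
  nlinarith [hple t ⟨htm.1.le, htm.2.le⟩]

theorem exists_forall_mem (h : IsScalarTrajectory κ γ a₁ a₂ p q) (hκ : 0 < κ)
    (hγ : 0 < γ) (ha₁ : 0 < a₁) (ha₂ : 0 < a₂) {s : ℝ} (hs : 0 ≤ s) (hp : p s ∈ Icc (-κ) κ)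
    (hq : q s = 0) : ∃ δ > 0, ∀ t ∈ Icc s (s + δ), p t ∈ Icc (-κ) κ ∧ q t = 0 := by
  rcases le_total 0 (p s) with h0 | h0
  · exact h.exists_forall_mem_of_nonneg hκ hγ ha₁ ha₂ hs h0 hp.2 hq
  · obtain ⟨δ, hδ, hmem⟩ := h.neg.exists_forall_mem_of_nonneg hκ hγ ha₁ ha₂ hs
      (neg_nonneg.2 h0) (by linarith [hp.1]) (by simp [hq])
    refine ⟨δ, hδ, fun t ht => ?_⟩
    obtain ⟨⟨h1, h2⟩, h3⟩ := hmem t ht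
    exact ⟨⟨by linarith, by linarith⟩, by linarith⟩

/-- The chattering set is forward invariant. -/
theorem mem_of_le (h : IsScalarTrajectory κ γ a₁ a₂ p q) (hκ : 0 < κ)
    (hγ : 0 < γ) (ha₁ : 0 < a₁) (ha₂ : 0 < a₂) {s t : ℝ} (hs : 0 ≤ s) (hst : s ≤ t)
    (hp : p s ∈ Icc (-κ) κ) (hq : q s = 0) : p t ∈ Icc (-κ) κ ∧ q t = 0 := by
  rcases hst.eq_or_lt with rfl | hlt
  · exact ⟨hp, hq⟩
  have hcp := (h.absCont_fst_of_le hs hlt).continuousOn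
  have hcq := (h.absCont_snd_of_le hs hlt).continuousOn
  rw [uIcc_of_le hst] at hcp hcq
  have hcl : IsClosed ({r | p r ∈ Icc (-κ) κ ∧ q r = 0} ∩ Icc s t) := by
    have := (hcp.prodMk hcq).preimage_isClosed_of_isClosed isClosed_Icc
      ((isClosed_Icc (a := -κ) (b := κ)).prod (isClosed_singleton (x := (0 : ℝ))))
    rw [inter_comm] at this
    exact this
  -- Continuous induction: the set of good times is closed and extends to the right of each of its
  -- points.
  refine hcl.Icc_subset_of_forall_exists_gt ⟨hp, hq⟩ (fun r hr y hy => ?_) (right_mem_Icc.2 hst)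
  obtain ⟨δ, hδ, hmem⟩ := h.exists_forall_mem hκ hγ ha₁ ha₂ (hs.trans hr.2.1) hr.1.1 hr.1.2
  have hy' : r < y := hy
  have hlt' : r < min (r + δ) y := lt_min (by linarith) hy'
  exact ⟨min (r + δ) y, hmem _ ⟨hlt'.le, min_le_left _ _⟩, hlt', min_le_right _ _⟩

/-- Every trajectory reaches the chattering set in finite time: off the switching line the energy
`p² / 2 + a₂ q² / 2 + γ |q|` decreases at rate at least `κ γ`. -/
theorem exists_mem (h : IsScalarTrajectory κ γ a₁ a₂ p q) (hκ : 0 < κ)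
    (hγ : 0 < γ) (ha₁ : 0 < a₁) (ha₂ : 0 < a₂) :
    ∃ s, 0 ≤ s ∧ p s ∈ Icc (-κ) κ ∧ q s = 0 := by
  by_contra! hne
  set W : ℝ → ℝ := fun t => 2⁻¹ * (p t * p t) + a₂ * 2⁻¹ * (q t * q t) + γ * |q t| with hW
  have hWnn : ∀ t, 0 ≤ W t := fun t => by
    have := mul_self_nonneg (p t)
    have := mul_self_nonneg (q t)
    positivity
  -- By this time a decay rate of `κ γ` would make `W` negative.
  set T : ℝ := W 0 / (κ * γ) + 1 with hT
  have hκγ : 0 < κ * γ := mul_pos hκ hγ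
  have hT0 : 0 < T := by have := hWnn 0; positivity
  have hp := h.absCont_fst T hT0
  have hq := h.absCont_snd T hT0
  have hac : AbsolutelyContinuousOnInterval W 0 T :=
    (((hp.fun_mul hp).const_mul _).fun_add ((hq.fun_mul hq).const_mul _)).fun_add
      (((lipschitzWith_one_norm (E := ℝ)).comp_absolutelyContinuousOnInterval hq).const_mul γ)
  have hle := hac.sub_le_mul_of_ae_deriv_le hT0.le (c := -(κ * γ)) (by
    filter_upwards [h.ae_hasDerivAt] with t ht htm
    obtain ⟨u, hu1, hdp, hdq, hpos, hneg, hz⟩ := ht htm.1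
    -- `σ` is the sign of `q t`; this treats both sides of the switching line at once.
    have hmain : ∀ σ : ℝ, HasDerivAt (fun t => |q t|) (σ * (p t - a₁ * q t - u * κ)) t →
        u = σ → σ * σ = 1 → 0 < σ * q t → ∃ d ≤ -(κ * γ), HasDerivAt W d t := by
      rintro σ hd rfl hσ hσq
      refine ⟨_, ?_, (((hdp.fun_mul hdp).const_mul _).fun_add
        ((hdq.fun_mul hdq).const_mul _)).fun_add (hd.const_mul γ)⟩
      have e : 2⁻¹ * ((-a₂ * q t - u * γ) * p t + p t * (-a₂ * q t - u * γ)) +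
          a₂ * 2⁻¹ * ((p t - a₁ * q t - u * κ) * q t + q t * (p t - a₁ * q t - u * κ)) +
          γ * (u * (p t - a₁ * q t - u * κ)) =
          -(a₁ * a₂ * (q t * q t)) - (a₁ * γ + a₂ * κ) * (u * q t) - κ * γ * (u * u) := by ring
      rw [e, hσ]
      have h1 : 0 ≤ a₁ * a₂ * (q t * q t) := mul_nonneg (by positivity) (mul_self_nonneg _)
      have h2 : 0 ≤ (a₁ * γ + a₂ * κ) * (u * q t) := mul_nonneg (by positivity) hσq.le
      linarith
    rcases lt_trichotomy (q t) 0 with hlt | h0 | hgt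
    · refine hmain (-1) ?_ (hneg hlt) (by norm_num) (by linarith)
      exact ((hasDerivAt_abs_neg hlt).comp t hdq)
    · refine absurd h0 (hne t htm.1.le ?_)
      rw [hz h0]
      constructor <;> nlinarith [hu1.1, hu1.2]
    · refine hmain 1 ?_ (hpos hgt) (by norm_num) (by linarith)
      exact ((hasDerivAt_abs_pos hgt).comp t hdq))
  have hTe : κ * γ * T = W 0 + κ * γ := by rw [hT]; field_simp
  linarith [hWnn T]

end IsScalarTrajectory


/-! ### Constant relay output: exit times, chattering set and exit map. -/

section ConstantRelay

variable {κ γ a₁ a₂ : ℝ}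

theorem constFlow_plant_hasDerivAt (ha₂ : 0 < a₂) (u : ℝ) (ξ : Fin 2 → ℝ) (t : ℝ) :
    HasDerivAt (fun t => constFlow (plantA a₁ a₂) (plantB κ γ) u ξ t 0)
      (-a₂ * constFlow (plantA a₁ a₂) (plantB κ γ) u ξ t 1 - u * γ) t ∧
    HasDerivAt (fun t => constFlow (plantA a₁ a₂) (plantB κ γ) u ξ t 1)
      (constFlow (plantA a₁ a₂) (plantB κ γ) u ξ t 0
        - a₁ * constFlow (plantA a₁ a₂) (plantB κ γ) u ξ t 1 - u * κ) t := by
  have hA : IsUnit (plantA a₁ a₂).det := by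
    rw [plantA, Matrix.det_fin_two_of]
    exact isUnit_iff_ne_zero.2 (by simpa using ha₂.ne')
  have h := hasDerivAt_pi.1 (constFlow_hasDerivAt (plantA a₁ a₂) (plantB κ γ) hA u ξ t)
  refine ⟨(h 0).congr_deriv ?_, (h 1).congr_deriv ?_⟩ <;>
    simp [plantA, plantB, dotProduct, Fin.sum_univ_two] <;> ring

theorem mem_exitTimesPlus_plant {ξ : Fin 2 → ℝ} {t : ℝ} :
    t ∈ exitTimesPlus (plantA a₁ a₂) (plantB κ γ) plantC ξ ↔
      0 < t ∧ constFlow (plantA a₁ a₂) (plantB κ γ) 1 ξ t 1 < 0 := by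
  rw [exitTimesPlus, mem_ofPred_eq, plantC_dotProduct]

theorem constFlow_neg (A : Matrix (Fin 2) (Fin 2) ℝ) (B : Fin 2 → ℝ) (u : ℝ) (ξ : Fin 2 → ℝ)
    (t : ℝ) : constFlow A B (-u) ξ t = -constFlow A B u (-ξ) t := by
  rw [constFlow, constFlow, neg_add, ← Matrix.mulVec_neg, neg_smul]
  congr 2
  abel

/-- The symmetry `x ↦ -x` exchanges the relay signs, so only output 1 needs study. -/
theorem exitTimesMinus_eq (A : Matrix (Fin 2) (Fin 2) ℝ) (B C ξ : Fin 2 → ℝ) :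
    exitTimesMinus A B C ξ = exitTimesPlus A B C (-ξ) := by
  ext t
  rw [exitTimesMinus, exitTimesPlus, mem_ofPred_eq, mem_ofPred_eq, constFlow_neg, dotProduct_neg,
    neg_pos]

/-- The two coordinates of a solution of the plant equation with constant relay output `1`. -/
structure IsPlusFlow (κ γ a₁ a₂ : ℝ) (p q : ℝ → ℝ) : Prop where
  fst : ∀ t, HasDerivAt p (-a₂ * q t - γ) t
  snd : ∀ t, HasDerivAt q (p t - a₁ * q t - κ) t

theorem isPlusFlow_constFlow (ha₂ : 0 < a₂) (ξ : Fin 2 → ℝ) :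
    IsPlusFlow κ γ a₁ a₂ (fun t => constFlow (plantA a₁ a₂) (plantB κ γ) 1 ξ t 0)
      (fun t => constFlow (plantA a₁ a₂) (plantB κ γ) 1 ξ t 1) :=
  ⟨fun t => by simpa using (constFlow_plant_hasDerivAt (κ := κ) (γ := γ) ha₂ 1 ξ t).1,
    fun t => by simpa using (constFlow_plant_hasDerivAt (κ := κ) (γ := γ) ha₂ 1 ξ t).2⟩

namespace IsPlusFlow

variable {p q : ℝ → ℝ}

theorem exists_pos_right (h : IsPlusFlow κ γ a₁ a₂ p q) {s : ℝ} (hq : q s = 0) (hp : κ < p s) :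
    ∃ ε > 0, ∀ t ∈ Ioo s (s + ε), 0 < q t :=
  (h.snd s).exists_pos_right hq (by rw [hq]; linarith)

theorem exists_neg_right (h : IsPlusFlow κ γ a₁ a₂ p q) (hγ : 0 < γ) {s : ℝ} (hq : q s = 0)
    (hp : p s ≤ κ) : ∃ ε > 0, ∀ t ∈ Ioo s (s + ε), q t < 0 := by
  rcases hp.lt_or_eq with hlt | heq
  · obtain ⟨ε, hε, hpos⟩ := (h.snd s).fun_neg.exists_pos_right (by simp [hq])
      (by rw [hq]; linarith)
    exact ⟨ε, hε, fun t ht => by linarith [hpos t ht]⟩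
  -- At the endpoint `p = κ` one has `q' = 0`, and second order decides: `q'' = -γ < 0`.
  · have hd := (((h.fst s).fun_sub ((h.snd s).const_mul a₁)).sub_const κ).fun_neg
    obtain ⟨ε, hε, hpos⟩ := hd.exists_pos_right (by simp [hq, heq]) (by rw [hq, heq]; linarith)
    refine ⟨ε, hε, fun t ht => ?_⟩
    have hanti : StrictAntiOn q (Icc s t) := by
      refine strictAntiOn_of_deriv_neg (convex_Icc s t)
        (fun r _ => (h.snd r).continuousAt.continuousWithinAt) fun r hr => ?_
      rw [interior_Icc] at hr
      rw [(h.snd r).deriv]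
      linarith [hpos r ⟨hr.1, hr.2.trans ht.2⟩]
    have := hanti (left_mem_Icc.2 ht.1.le) (right_mem_Icc.2 ht.1.le) ht.1
    linarith

/-- With constant relay output `1`, the output becomes negative in finite time: while it is
nonnegative, the energy `p² / 2 + a₂ q² / 2 + γ q` decreases at rate at least `κ γ`. -/
theorem exists_neg (h : IsPlusFlow κ γ a₁ a₂ p q) (hκ : 0 < κ) (hγ : 0 < γ) (ha₁ : 0 < a₁)
    (ha₂ : 0 < a₂) : ∃ t, 0 < t ∧ q t < 0 := by
  by_contra! hnn
  -- The term `κ γ t` absorbs the decay rate: `V` is antitone, yet at least `κ γ t` while `q ≥ 0`.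
  set V : ℝ → ℝ := fun t =>
    2⁻¹ * (p t * p t) + a₂ * 2⁻¹ * (q t * q t) + γ * q t + κ * γ * t with hV
  have hd : ∀ t, HasDerivAt V
      (-(a₁ * a₂ * (q t * q t)) - (a₁ * γ + a₂ * κ) * q t) t := fun t =>
    (((((h.fst t).fun_mul (h.fst t)).const_mul _).fun_add
      (((h.snd t).fun_mul (h.snd t)).const_mul _)).fun_add ((h.snd t).const_mul γ)).fun_add
      ((hasDerivAt_id t).const_mul (κ * γ)) |>.congr_deriv (by ring)
  have hanti : AntitoneOn V (Ici 1) := by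
    refine antitoneOn_of_deriv_nonpos (convex_Ici 1)
      (fun r _ => (hd r).continuousAt.continuousWithinAt)
      (fun r _ => (hd r).differentiableAt.differentiableWithinAt) fun r hr => ?_
    rw [interior_Ici] at hr
    rw [(hd r).deriv]
    have hq : 0 ≤ q r := hnn r (zero_lt_one.trans hr)
    have : 0 ≤ a₁ * a₂ * (q r * q r) + (a₁ * γ + a₂ * κ) * q r := by positivity
    linarith
  have hκγ : 0 < κ * γ := mul_pos hκ hγ
  obtain ⟨T, hT⟩ := exists_gt (max 1 (V 1 / (κ * γ)))
  have hT1 : 1 < T := (le_max_left _ _).trans_lt hT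
  have hTV : V 1 < T * (κ * γ) := (div_lt_iff₀ hκγ).1 ((le_max_right _ _).trans_lt hT)
  have hle : V T ≤ V 1 := hanti (mem_Ici.2 le_rfl) (mem_Ici.2 hT1.le) hT1.le
  have hq : 0 ≤ q T := hnn T (by linarith)
  have hp := mul_self_nonneg (p T)
  have : 0 ≤ 2⁻¹ * (p T * p T) + a₂ * 2⁻¹ * (q T * q T) + γ * q T := by positivity
  simp only [hV] at hle hTV
  linarith

/-- The energy `(p - κ)² / 2 + a₂ q² / 2 + γ q` does not increase while the output is
nonnegative, and strictly decreases while it is positive. -/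
theorem energy_hasDerivAt (h : IsPlusFlow κ γ a₁ a₂ p q) (t : ℝ) :
    HasDerivAt (fun t => 2⁻¹ * ((p t - κ) * (p t - κ)) + a₂ * 2⁻¹ * (q t * q t) + γ * q t)
      (-(a₁ * q t * (a₂ * q t + γ))) t :=
  (((((h.fst t).sub_const κ).fun_mul ((h.fst t).sub_const κ)).const_mul _).fun_add
    (((h.snd t).fun_mul (h.snd t)).const_mul _)).fun_add ((h.snd t).const_mul γ)
    |>.congr_deriv (by ring)

/-- From a point of the switching line to the right of `κ`, the first exit from the positive half
plane happens strictly later, at a point `(f, 0)` with `κ - (ξ - κ) < f ≤ κ`. -/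
theorem exit_bounds (h : IsPlusFlow κ γ a₁ a₂ p q) (hκ : 0 < κ) (hγ : 0 < γ) (ha₁ : 0 < a₁)
    (ha₂ : 0 < a₂) (hq0 : q 0 = 0) (hp0 : κ < p 0) :
    p (sInf {t | 0 < t ∧ q t < 0}) ≤ κ ∧ 2 * κ - p 0 < p (sInf {t | 0 < t ∧ q t < 0}) := by
  set S : Set ℝ := {t | 0 < t ∧ q t < 0} with hS
  set τ := sInf S with hτ
  have hne : S.Nonempty := h.exists_neg hκ hγ ha₁ ha₂
  have hbdd : BddBelow S := ⟨0, fun t ht => ht.1.le⟩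
  obtain ⟨ε, hε, hpos⟩ := h.exists_pos_right hq0 hp0
  rw [zero_add] at hpos
  have hετ : ε ≤ τ := le_csInf hne fun t ht => by
    by_contra! hlt
    exact (hpos t ⟨ht.1, hlt⟩).not_gt ht.2
  have hτ0 : 0 < τ := hε.trans_le hετ
  have hcont : Continuous q := continuous_iff_continuousAt.2 fun t => (h.snd t).continuousAt
  have hnn : ∀ t ∈ Ioo 0 τ, 0 ≤ q t := fun t ht => by
    by_contra! hlt
    exact ht.2.not_ge (csInf_le hbdd ⟨ht.1, hlt⟩)
  have hqτ : q τ = 0 := by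
    apply le_antisymm
    · have hmem : τ ∈ closure S := csInf_mem_closure hne hbdd
      exact closure_minimal (fun t ht => ht.2.le) (isClosed_Iic.preimage hcont) hmem
    · have hmem : τ ∈ closure (Ioo 0 τ) := by
        rw [closure_Ioo hτ0.ne]; exact right_mem_Icc.2 hτ0.le
      exact closure_minimal hnn (isClosed_Ici.preimage hcont) hmem
  have hpτ : p τ ≤ κ := by
    by_contra! hlt
    -- The output would be positive just after `τ`, where exit times must accumulate.
    obtain ⟨δ, hδ, hposτ⟩ := h.exists_pos_right hqτ hlt
    obtain ⟨t, ht, htτ⟩ := exists_lt_of_csInf_lt hne (show τ < τ + δ by linarith)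
    rcases (csInf_le hbdd ht).eq_or_lt with heq | hgt
    · exact absurd (heq ▸ hqτ) ht.2.ne
    · exact (hposτ t ⟨hgt, htτ⟩).not_gt ht.2
  refine ⟨hpτ, ?_⟩
  set E : ℝ → ℝ := fun t =>
    2⁻¹ * ((p t - κ) * (p t - κ)) + a₂ * 2⁻¹ * (q t * q t) + γ * q t with hE
  have hd : ∀ t, HasDerivAt E (-(a₁ * q t * (a₂ * q t + γ))) t := h.energy_hasDerivAt
  -- Strictness comes from the initial stretch, where `q > 0` is known; later only `q ≥ 0` is.
  have hstrict : StrictAntiOn E (Icc 0 ε) := by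
    refine strictAntiOn_of_deriv_neg (convex_Icc 0 ε)
      (fun r _ => (hd r).continuousAt.continuousWithinAt) fun r hr => ?_
    rw [interior_Icc] at hr
    rw [(hd r).deriv, neg_lt_zero]
    have := hpos r hr
    positivity
  have hanti : AntitoneOn E (Icc 0 τ) := by
    refine antitoneOn_of_deriv_nonpos (convex_Icc 0 τ)
      (fun r _ => (hd r).continuousAt.continuousWithinAt)
      (fun r _ => (hd r).differentiableAt.differentiableWithinAt) fun r hr => ?_
    rw [interior_Icc] at hr
    rw [(hd r).deriv, neg_nonpos]
    have := hnn r hr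
    positivity
  have h1 : E ε < E 0 := hstrict (left_mem_Icc.2 hε.le) (right_mem_Icc.2 hε.le) hε
  have h2 : E τ ≤ E ε := hanti ⟨hε.le, hετ⟩ (right_mem_Icc.2 hτ0.le) hετ
  have h3 := h2.trans_lt h1
  simp only [hE, hqτ, hq0] at h3
  nlinarith

end IsPlusFlow

theorem isGLB_exitTimesPlus_iff (hγ : 0 < γ) (ha₂ : 0 < a₂) {ξ : Fin 2 → ℝ} (hξ : ξ 1 = 0) :
    IsGLB (exitTimesPlus (plantA a₁ a₂) (plantB κ γ) plantC ξ) 0 ↔ ξ 0 ≤ κ := by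
  have hflow := isPlusFlow_constFlow (κ := κ) (γ := γ) (a₁ := a₁) ha₂ ξ
  have hz := constFlow_zero (plantA a₁ a₂) (plantB κ γ) 1 ξ
  constructor
  · intro hglb
    by_contra! hlt
    obtain ⟨ε, hε, hpos⟩ := hflow.exists_pos_right (s := 0) (by rw [hz, hξ]) (by rwa [hz])
    refine hε.not_ge (hglb.2 fun t ht => ?_)
    rw [mem_exitTimesPlus_plant] at ht
    by_contra! hltε
    exact (hpos t ⟨ht.1, by linarith⟩).not_gt ht.2
  · intro hle
    obtain ⟨ε, hε, hneg⟩ := hflow.exists_neg_right hγ (s := 0) (by rw [hz, hξ]) (by rwa [hz])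
    refine ⟨fun t ht => ht.1.le, fun b hb => ?_⟩
    by_contra! hb0
    have hmin : 0 < min b ε := lt_min hb0 hε
    have hmem : min b ε / 2 ∈ exitTimesPlus (plantA a₁ a₂) (plantB κ γ) plantC ξ :=
      mem_exitTimesPlus_plant.2 ⟨by linarith, hneg _ ⟨by linarith,
        by linarith [min_le_right b ε]⟩⟩
    linarith [hb hmem, min_le_left b ε]

theorem exitTimesPlus_nonempty (hκ : 0 < κ) (hγ : 0 < γ) (ha₁ : 0 < a₁) (ha₂ : 0 < a₂)
    (ξ : Fin 2 → ℝ) : (exitTimesPlus (plantA a₁ a₂) (plantB κ γ) plantC ξ).Nonempty := by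
  obtain ⟨t, ht⟩ := (isPlusFlow_constFlow (κ := κ) (γ := γ) (a₁ := a₁) ha₂ ξ).exists_neg
    hκ hγ ha₁ ha₂
  exact ⟨t, mem_exitTimesPlus_plant.2 ht⟩

/-- The chattering set of the plant is a segment of the switching line. -/
theorem chatteringSet_plant (hγ : 0 < γ) (ha₂ : 0 < a₂) :
    chatteringSet (plantA a₁ a₂) (plantB κ γ) plantC
      = {x : Fin 2 → ℝ | x 0 ∈ Icc (-κ) κ ∧ x 1 = 0} := by
  ext ξ
  rw [chatteringSet, mem_ofPred_eq, mem_ofPred_eq, plantC_dotProduct, exitTimesMinus_eq]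
  constructor
  · rintro ⟨h0, hp, hm⟩
    rw [isGLB_exitTimesPlus_iff hγ ha₂ h0] at hp
    rw [isGLB_exitTimesPlus_iff hγ ha₂ (by simp [h0]), Pi.neg_apply] at hm
    exact ⟨⟨by linarith, hp⟩, h0⟩
  · rintro ⟨⟨hm, hp⟩, h0⟩
    refine ⟨h0, (isGLB_exitTimesPlus_iff hγ ha₂ h0).2 hp,
      (isGLB_exitTimesPlus_iff hγ ha₂ (by simp [h0])).2 ?_⟩
    rw [Pi.neg_apply]
    linarith

/-- As an order box with one side of length zero, the segment is visibly bounded and null. -/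
theorem segment_eq_Icc (κ : ℝ) :
    {x : Fin 2 → ℝ | x 0 ∈ Icc (-κ) κ ∧ x 1 = 0} = Icc ![-κ, 0] ![κ, 0] := by
  ext x
  simp only [mem_ofPred_eq, mem_Icc, Pi.le_def, Fin.forall_fin_two, Matrix.cons_val_zero,
    Matrix.cons_val_one]
  constructor
  · rintro ⟨⟨h1, h2⟩, h3⟩
    exact ⟨⟨h1, h3.ge⟩, h2, h3.le⟩
  · rintro ⟨⟨h1, h3⟩, h2, h4⟩
    exact ⟨⟨h1, h2⟩, le_antisymm h4 h3⟩

theorem fPlus_of_le (hγ : 0 < γ) (ha₂ : 0 < a₂) (hκ : 0 < κ) (ha₁ : 0 < a₁) {ξ : ℝ}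
    (hξ : ξ ≤ κ) : fPlus (plantA a₁ a₂) (plantB κ γ) plantC ξ = ξ := by
  have hglb := (isGLB_exitTimesPlus_iff (κ := κ) (γ := γ) (a₁ := a₁) hγ ha₂
    (ξ := ![ξ, 0]) (by simp)).2 (by simpa using hξ)
  rw [fPlus, psiPlus, tauPlus, hglb.csInf_eq (exitTimesPlus_nonempty hκ hγ ha₁ ha₂ _),
    constFlow_zero]
  simp

theorem fPlus_bounds (hγ : 0 < γ) (ha₂ : 0 < a₂) (hκ : 0 < κ) (ha₁ : 0 < a₁) {ξ : ℝ}
    (hξ : κ < ξ) : fPlus (plantA a₁ a₂) (plantB κ γ) plantC ξ ≤ κ ∧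
      2 * κ - ξ < fPlus (plantA a₁ a₂) (plantB κ γ) plantC ξ := by
  have hz := constFlow_zero (plantA a₁ a₂) (plantB κ γ) 1 ![ξ, 0]
  have h := (isPlusFlow_constFlow (κ := κ) (γ := γ) (a₁ := a₁) ha₂ ![ξ, 0]).exit_bounds
    hκ hγ ha₁ ha₂ (by rw [hz]; simp) (by rw [hz]; simpa using hξ)
  have hS : {t | 0 < t ∧ constFlow (plantA a₁ a₂) (plantB κ γ) 1 ![ξ, 0] t 1 < 0}
      = exitTimesPlus (plantA a₁ a₂) (plantB κ γ) plantC ![ξ, 0] :=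
    Set.ext fun t => mem_exitTimesPlus_plant.symm
  rw [hS, hz] at h
  simpa [fPlus, psiPlus, tauPlus] using h

end ConstantRelay

/-! ### Iteration of the switching map and conclusion. -/

/-- A map that fixes `(-∞, κ]` and sends `ξ > κ` into `(2 κ - ξ, κ]`, iterated with a sign change,
enters `[-κ, κ]` for good; from the first iterate on, each step outside loses more than `2 κ`. -/
theorem iterate_neg_eventually_mem_Icc {κ : ℝ} (hκ : 0 < κ) {f : ℝ → ℝ}
    (hfix : ∀ ξ ≤ κ, f ξ = ξ) (hle : ∀ ξ, κ < ξ → f ξ ≤ κ)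
    (hlt : ∀ ξ, κ < ξ → 2 * κ - ξ < f ξ) (ξ₀ : ℝ) :
    (∀ n : ℕ, 1 ≤ n → (fun ξ => -f ξ)^[n] ξ₀ ∈ Icc (-κ) κ ∨
      (fun ξ => -f ξ)^[n + 1] ξ₀ < (fun ξ => -f ξ)^[n] ξ₀ - 2 * κ) ∧
    ∃ N : ℕ, ∀ n : ℕ, N ≤ n → (fun ξ => -f ξ)^[n] ξ₀ ∈ Icc (-κ) κ := by
  set g : ℕ → ℝ := fun n => (fun ξ => -f ξ)^[n] ξ₀ with hg
  have hsucc : ∀ n, g (n + 1) = -f (g n) := fun n => Function.iterate_succ_apply' _ n ξ₀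
  -- Every value of `-f` is at least `-κ`, but `ξ₀` itself may lie below, hence `1 ≤ n`.
  have hlow : ∀ n, 1 ≤ n → -κ ≤ g n := by
    intro n hn
    obtain ⟨m, rfl⟩ := Nat.exists_eq_add_of_le' hn
    rw [hsucc]
    rcases le_or_gt (g m) κ with h | h
    · rw [hfix _ h]; linarith
    · linarith [hle _ h]
  have hstep : ∀ n, 1 ≤ n → g n ∈ Icc (-κ) κ ∨ g (n + 1) < g n - 2 * κ := by
    intro n hn
    rcases le_or_gt (g n) κ with h | h
    · exact Or.inl ⟨hlow n hn, h⟩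
    · right
      rw [hsucc]
      linarith [hlt _ h]
  refine ⟨hstep, ?_⟩
  have hex : ∃ N, g N ∈ Icc (-κ) κ := by
    by_contra! hne
    have hdec : ∀ n : ℕ, g (n + 1) ≤ g 1 - n * (2 * κ) := by
      intro n
      induction n with
      | zero => simp
      | succ n ih =>
        have := (hstep (n + 1) (by omega)).resolve_left (hne _)
        push_cast
        linarith
    obtain ⟨n, hn⟩ := exists_nat_gt ((g 1 + κ) / (2 * κ))
    rw [div_lt_iff₀ (by positivity)] at hn
    linarith [hdec n, hlow (n + 1) (by omega)]
  obtain ⟨N, hN⟩ := hex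
  refine ⟨N, fun n hn => ?_⟩
  -- On `[-κ, κ]` the iterated map is `ξ ↦ -ξ`, which preserves the interval.
  induction n, hn using Nat.le_induction with
  | base => exact hN
  | succ n _ ih =>
    change g (n + 1) ∈ _
    have ih' : g n ∈ Icc (-κ) κ := ih
    rw [hsucc, hfix _ ih'.2]
    exact ⟨neg_le_neg ih'.2, by linarith [ih'.1]⟩

end RelayFeedback

open RelayFeedback in
theorem mainTheorem4 (κ γ a₁ a₂ : ℝ) (hκ : 0 < κ) (hγ : 0 < γ) (ha₁ : 0 < a₁) (ha₂ : 0 < a₂) :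
    -- the chattering set, which is bounded and of measure zero
    chatteringSet (plantA a₁ a₂) (plantB κ γ) plantC
        = {x : Fin 2 → ℝ | x 0 ∈ Set.Icc (-κ) κ ∧ x 1 = 0} ∧
    Bornology.IsBounded (chatteringSet (plantA a₁ a₂) (plantB κ γ) plantC) ∧
    volume (chatteringSet (plantA a₁ a₂) (plantB κ γ) plantC) = 0 ∧
    -- the switching point transformation function is defined on the whole switching line
    (∀ ξ : ℝ, (exitTimesPlus (plantA a₁ a₂) (plantB κ γ) plantC ![ξ, 0]).Nonempty) ∧
    -- each step decreases a switching point beyond the chattering set by more than `2 κ`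
    (∀ ξ : ℝ, κ < ξ → -fPlus (plantA a₁ a₂) (plantB κ γ) plantC ξ < ξ - 2 * κ) ∧
    -- from the second element on, this happens until the chattering set is reached for good
    (∀ ξ₀ : ℝ,
      (∀ n : ℕ, 1 ≤ n →
        switchingSeq (plantA a₁ a₂) (plantB κ γ) plantC ξ₀ n ∈ Set.Icc (-κ) κ ∨
        switchingSeq (plantA a₁ a₂) (plantB κ γ) plantC ξ₀ (n + 1)
          < switchingSeq (plantA a₁ a₂) (plantB κ γ) plantC ξ₀ n - 2 * κ) ∧
      ∃ N : ℕ, ∀ n : ℕ, N ≤ n →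
        switchingSeq (plantA a₁ a₂) (plantB κ γ) plantC ξ₀ n ∈ Set.Icc (-κ) κ) ∧
    -- every trajectory stays in the chattering set once it is there, and converges to it
    (∀ x : ℝ → Fin 2 → ℝ, IsTrajectory (plantA a₁ a₂) (plantB κ γ) plantC x →
      (∀ s t : ℝ, 0 ≤ s → s ≤ t →
        x s ∈ chatteringSet (plantA a₁ a₂) (plantB κ γ) plantC →
        x t ∈ chatteringSet (plantA a₁ a₂) (plantB κ γ) plantC) ∧
      Tendsto (fun t => Metric.infDist (x t)
        (chatteringSet (plantA a₁ a₂) (plantB κ γ) plantC)) atTop (𝓝 0)) := by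
  have hK : chatteringSet (plantA a₁ a₂) (plantB κ γ) plantC
      = {x : Fin 2 → ℝ | x 0 ∈ Set.Icc (-κ) κ ∧ x 1 = 0} := chatteringSet_plant hγ ha₂
  refine ⟨hK, ?_, ?_, fun ξ => exitTimesPlus_nonempty hκ hγ ha₁ ha₂ _, fun ξ hξ => ?_,
    fun ξ₀ => ?_, fun x hx => ?_⟩
  · rw [hK, segment_eq_Icc]
    exact Metric.isBounded_Icc _ _
  · rw [hK, segment_eq_Icc, Real.volume_Icc_pi]
    simp
  · linarith [(fPlus_bounds (κ := κ) (γ := γ) hγ ha₂ hκ ha₁ hξ).2]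
  · exact iterate_neg_eventually_mem_Icc hκ (fun ξ hξ => fPlus_of_le hγ ha₂ hκ ha₁ hξ)
      (fun ξ hξ => (fPlus_bounds hγ ha₂ hκ ha₁ hξ).1)
      (fun ξ hξ => (fPlus_bounds hγ ha₂ hκ ha₁ hξ).2) ξ₀
  · have hs := hx.isScalarTrajectory
    have hinv : ∀ s t : ℝ, 0 ≤ s → s ≤ t →
        x s ∈ chatteringSet (plantA a₁ a₂) (plantB κ γ) plantC →
        x t ∈ chatteringSet (plantA a₁ a₂) (plantB κ γ) plantC := by
      intro s t h0 hst hmem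
      rw [hK] at hmem ⊢
      exact hs.mem_of_le hκ hγ ha₁ ha₂ h0 hst hmem.1 hmem.2
    refine ⟨hinv, ?_⟩
    obtain ⟨s, h0, hp, hq⟩ := hs.exists_mem hκ hγ ha₁ ha₂
    have hsK : x s ∈ chatteringSet (plantA a₁ a₂) (plantB κ γ) plantC := by
      rw [hK]; exact ⟨hp, hq⟩
    refine tendsto_const_nhds.congr' ?_
    filter_upwards [eventually_ge_atTop s] with t ht
    exact (Metric.infDist_zero_of_mem (hinv s t h0 ht hsK)).symm
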